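/- Let $(X_i)_{i\ge 1}$ and $(Y_i)_{i\ge 1}$ be sequences of real random variables on a common probability space such that the pairs $(X_i,Y_i)$, $i\ge 1$, are mutually independent and, for each $i$, $X_i$ and $Y_i$ are independent. Suppose that $X_i$ is a Bernoulli variable with $P(X_i=1)=g_i$ (the $g_i\in[0,1]$ may differ), and that the $Y_i$ are identically distributed with $\mathbb E[Y_1^4]<\infty$ and $\operatorname{Var}(Y_1)>0$ (for instance, non-degenerate scores in $[0,1]$). Suppose further that there are $g^{(1)}\in(0,1)$ and $g^{(2)}\in[0,1]$ such that, as $T\to\infty$, $$\frac1T\sum_{i=1}^T\bigl(g_i-g^{(1)}\bigr)=O\!\left(\frac1T\right)\qquad\text{and}\qquad \frac1T\sum_{i=1}^T g_i^2\to g^{(2)}.$$ For $T\ge 1$ let $\bar X_T=\frac1T\sum_{t=1}^T X_t$, $\bar Y_T=\frac1T\sum_{t=1}^T Y_t$, and let $$S_T=\frac{\sum_{t=1}^T (X_t-\bar X_T)(Y_t-\bar Y_T)}{\sqrt{\sum_{t=1}^T (X_t-\bar X_T)^2\,\sum_{t=1}^T (Y_t-\bar Y_T)^2}}$$ be the sample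 Pearson correlation coefficient, with $S_T:=0$ where the denominator vanishes. Then, as $T\to\infty$, $$\sqrt T\,S_T\xrightarrow{d}\mathcal N(0,1).$$ -/

import Mathlib

open MeasureTheory ProbabilityTheory Filter Topology Asymptotics

/-- The mean of the first `T` terms `x 0, …, x (T - 1)` of a real sequence. -/
noncomputable def sampleMean (T : ℕ) (x : ℕ → ℝ) : ℝ :=
  (∑ t ∈ Finset.range T, x t) / T

/-- The sample Pearson correlation coefficient of the first `T` terms of `x` and `y`
(equal to `0` when the denominator vanishes). -/
noncomputable def sampleCorr (T : ℕ) (x y : ℕ → ℝ) : ℝ :=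
  (∑ t ∈ Finset.range T, (x t - sampleMean T x) * (y t - sampleMean T y)) /
    √((∑ t ∈ Finset.range T, (x t - sampleMean T x) ^ 2) *
      ∑ t ∈ Finset.range T, (y t - sampleMean T y) ^ 2)

/-! Correlation is invariant under increasing affine maps of `Y`, so `Y` may be replaced by its
standardization `W`. With `a = g₁`, `√T * S_T` is a quotient. Its numerator is `T^(-1/2) ∑ (X i - a)
W i` minus `(X̄ - a) * T^(-1/2) ∑ W i`; its denominator tends to `√(a (1 - a))` in probability by
laws of large numbers. The subtracted term vanishes in `L¹`, so Slutsky's theorem reduces everything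
to a CLT for the first sum.

The summands there are centered because `W i` is, whatever `g i` is. They are not identically
distributed, but each characteristic function mixes two values of the single function `φ` of `W 0`
(`charFun_map_bernoulli_sub_mul`). One Taylor expansion of `φ` therefore controls all factors
uniformly and no Lindeberg condition is needed. The variances are affine in `g i`, so the Cesàro
limit of `g` determines the limiting variance `a (1 - a)`. -/

/-! ### Products of complex numbers close to 1 -/

/-- Factors are exchanged one at a time; the remaining ones have norm at most 1. -/
lemma norm_prod_sub_prod_le_sum {ι : Type*} (s : Finset ι) {z w : ι → ℂ}
    (hz : ∀ i, ‖z i‖ ≤ 1) (hw : ∀ i, ‖w i‖ ≤ 1) :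
    ‖∏ i ∈ s, z i - ∏ i ∈ s, w i‖ ≤ ∑ i ∈ s, ‖z i - w i‖ := by
  classical
  induction s using Finset.induction with
  | empty => simp
  | insert a s ha ih =>
    rw [Finset.prod_insert ha, Finset.prod_insert ha, Finset.sum_insert ha]
    have hp : ‖∏ i ∈ s, z i‖ ≤ 1 := by
      rw [norm_prod]
      exact Finset.prod_le_one (fun i _ ↦ norm_nonneg _) fun i _ ↦ hz i
    calc ‖z a * ∏ i ∈ s, z i - w a * ∏ i ∈ s, w i‖
        = ‖(z a - w a) * ∏ i ∈ s, z i + w a * (∏ i ∈ s, z i - ∏ i ∈ s, w i)‖ := by ring_nf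
      _ ≤ ‖z a - w a‖ * ‖∏ i ∈ s, z i‖ + ‖w a‖ * ‖∏ i ∈ s, z i - ∏ i ∈ s, w i‖ := by
        rw [← norm_mul, ← norm_mul]; exact norm_add_le _ _
      _ ≤ ‖z a - w a‖ * 1 + 1 * ∑ i ∈ s, ‖z i - w i‖ := by
        gcongr
        exact hw a
      _ = _ := by ring

/-- A product of `n` complex numbers `z n i = 1 - q i / n + o(1 / n)` in the unit disc, uniformly
in `i`, tends to `exp (-L)`, where `L` is the Cesàro limit of `q`. -/
lemma tendsto_prod_exp_neg_of_norm_sub_le {z : ℕ → ℕ → ℂ} {q : ℕ → ℝ} {r : ℕ → ℝ} {C L : ℝ}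
    (hq0 : ∀ i, 0 ≤ q i) (hqC : ∀ i, q i ≤ C) (hz : ∀ n i, ‖z n i‖ ≤ 1)
    (hr : ∀ n i, ‖z n i - (1 - (q i / n : ℝ))‖ ≤ r n)
    (hr0 : Tendsto (fun n : ℕ ↦ n * r n) atTop (𝓝 0))
    (hL : Tendsto (fun n : ℕ ↦ (1 / (n : ℝ)) * ∑ i ∈ Finset.range n, q i) atTop (𝓝 L)) :
    Tendsto (fun n ↦ ∏ i ∈ Finset.range n, z n i) atTop (𝓝 (Complex.exp (-L))) := by
  have hC : 0 ≤ C := (hq0 0).trans (hqC 0)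
  have hexp : Tendsto (fun n : ℕ ↦ ∏ i ∈ Finset.range n, Complex.exp (-(q i / n : ℝ))) atTop
      (𝓝 (Complex.exp (-L))) := by
    have h := (Complex.continuous_exp.tendsto _).comp
      ((Complex.continuous_ofReal.tendsto _).comp hL).neg
    refine h.congr fun n ↦ ?_
    simp only [Function.comp_apply]
    rw [← Complex.exp_sum, Finset.mul_sum, Complex.ofReal_sum, Finset.sum_neg_distrib]
    congr 2
    refine Finset.sum_congr rfl fun i _ ↦ ?_
    push_cast; ring
  refine tendsto_of_tendsto_of_dist hexp ?_
  have hbound : Tendsto (fun n : ℕ ↦ n * r n + C ^ 2 * (1 / (n : ℝ))) atTop (𝓝 0) := by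
    simpa using hr0.add (tendsto_one_div_atTop_nhds_zero_nat.const_mul (C ^ 2))
  refine squeeze_zero' (.of_forall fun n ↦ dist_nonneg) ?_ hbound
  -- `n ≥ C` puts `q i / n` in `[0, 1]`, where the quadratic bound on `exp x - 1 - x` applies.
  filter_upwards [eventually_gt_atTop 0, eventually_ge_atTop ⌈C⌉₊] with n hn hnC
  have hn' : (0 : ℝ) < n := by exact_mod_cast hn
  have hCn : C ≤ n := Nat.ceil_le.1 hnC
  have key i : ‖Complex.exp (-(q i / n : ℝ)) - z n i‖ ≤ r n + (C / n) ^ 2 := by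
    have hqn : 0 ≤ q i / n := div_nonneg (hq0 i) hn'.le
    have h1 : ‖(-(q i / n : ℝ) : ℂ)‖ = q i / n := by
      rw [norm_neg, Complex.norm_real, Real.norm_of_nonneg hqn]
    have h2 := Complex.norm_exp_sub_one_sub_id_le (x := (-(q i / n : ℝ) : ℂ))
      (by rw [h1, div_le_one hn']; exact (hqC i).trans hCn)
    rw [h1] at h2
    have h3 : (q i / n) ^ 2 ≤ (C / n) ^ 2 := by gcongr; exact hqC i
    calc ‖Complex.exp (-(q i / n : ℝ)) - z n i‖
        = ‖(Complex.exp (-(q i / n : ℝ)) - 1 - (-(q i / n : ℝ)))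
            - (z n i - (1 - (q i / n : ℝ)))‖ := by ring_nf
      _ ≤ (q i / n) ^ 2 + r n := (norm_sub_le _ _).trans (add_le_add h2 (hr n i))
      _ ≤ _ := by linarith
  rw [dist_eq_norm]
  calc _ ≤ ∑ i ∈ Finset.range n, ‖Complex.exp (-(q i / n : ℝ)) - z n i‖ := by
        refine norm_prod_sub_prod_le_sum _ (fun i ↦ ?_) (hz n)
        rw [← Complex.ofReal_neg, ← Complex.ofReal_exp, Complex.norm_real,
          Real.norm_of_nonneg (Real.exp_nonneg _), Real.exp_le_one_iff, neg_nonpos]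
        exact div_nonneg (hq0 i) hn'.le
    _ ≤ ∑ i ∈ Finset.range n, (r n + (C / n) ^ 2) := Finset.sum_le_sum fun i _ ↦ key i
    _ = n * r n + C ^ 2 * (1 / (n : ℝ)) := by
        rw [Finset.sum_const, Finset.card_range, nsmul_eq_mul]; field_simp

/-! ### Central limit theorem for Bernoulli-weighted sums -/

section

variable {Ω : Type*} [MeasurableSpace Ω] {μ : Measure Ω}

lemma integral_bernoulli {X : Ω → ℝ} {p : ℝ} (hX : Measurable X)
    (hX01 : ∀ᵐ ω ∂μ, X ω = 0 ∨ X ω = 1) (hXp : μ.real {ω | X ω = 1} = p) :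
    ∫ ω, X ω ∂μ = p := by
  have h : X =ᵐ[μ] {ω | X ω = 1}.indicator 1 := by
    filter_upwards [hX01] with ω hω
    rcases hω with h | h <;> simp [Set.indicator, h]
  have hm : MeasurableSet {ω | X ω = 1} := hX (measurableSet_singleton 1)
  rw [integral_congr_ae h, integral_indicator_one hm, hXp]

variable [IsProbabilityMeasure μ]

/-- The characteristic function of `(X - a) * W`, where `X` is a Bernoulli variable with
parameter `p` that is independent of `W`. -/
lemma charFun_map_bernoulli_sub_mul {X W : Ω → ℝ} {p : ℝ} (hX : Measurable X) (hW : Measurable W)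
    (hX01 : ∀ᵐ ω ∂μ, X ω = 0 ∨ X ω = 1) (hXp : μ.real {ω | X ω = 1} = p)
    (hXW : IndepFun X W μ) (a t : ℝ) :
    charFun (μ.map fun ω ↦ (X ω - a) * W ω) t =
      p * charFun (μ.map W) ((1 - a) * t) + (1 - p) * charFun (μ.map W) (-a * t) := by
  have hi (f : ℝ → ℂ) (hf : Measurable f) (c : ℝ) :
      ∫ ω, f (X ω) * Complex.exp (c * t * W ω * Complex.I) ∂μ =
        (∫ ω, f (X ω) ∂μ) * charFun (μ.map W) (c * t) := by
    rw [charFun_apply_real, integral_map hW.aemeasurable (by fun_prop)]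
    push_cast
    exact hXW.integral_fun_comp_mul_comp (f := f)
      (g := fun w : ℝ ↦ Complex.exp (c * t * w * Complex.I)) hX.aemeasurable hW.aemeasurable
      hf.aestronglyMeasurable (by fun_prop)
  have hXint : Integrable (fun ω ↦ (X ω : ℂ)) μ := by
    refine Integrable.of_bound (by fun_prop) 1 ?_
    filter_upwards [hX01] with ω hω
    rcases hω with h | h <;> simp [h]
  have hb (f : Ω → ℂ) (hf : Integrable f μ) (c : ℝ) :
      Integrable (fun ω ↦ f ω * Complex.exp (c * t * W ω * Complex.I)) μ := by
    refine hf.mul_bdd (c := 1) (by fun_prop) (.of_forall fun ω ↦ ?_)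
    have := Complex.norm_exp_ofReal_mul_I (c * t * W ω)
    push_cast at this
    exact this.le
  rw [charFun_apply_real, integral_map (by fun_prop) (by fun_prop)]
  have hp : ∫ ω, (X ω : ℂ) ∂μ = p := by
    rw [integral_complex_ofReal, integral_bernoulli hX hX01 hXp]
  have hp' : ∫ ω, (1 - (X ω : ℂ)) ∂μ = 1 - p := by
    rw [integral_sub (integrable_const _) hXint, hp]; simp
  -- `X` and `1 - X` serve as the indicators of the two values of `X`.
  rw [← hp', ← hp, ← hi (fun x ↦ (x : ℂ)) (by fun_prop), ← hi (fun x ↦ 1 - (x : ℂ)) (by fun_prop),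
    ← integral_add (hb _ hXint _) (hb (fun ω ↦ 1 - (X ω : ℂ)) ((integrable_const _).sub hXint) _)]
  refine integral_congr_ae ?_
  filter_upwards [hX01] with ω hω
  rcases hω with h | h <;> simp only [h] <;> push_cast <;> simp <;> ring_nf

/-- A central limit theorem for `(X i - a) * W i`, where the `X i` are Bernoulli variables whose
parameters have Cesàro mean `a`, and the `W i` are i.i.d. standardized variables. -/
lemma tendstoInDistribution_bernoulli_sub_mul {X W : ℕ → Ω → ℝ} {g : ℕ → ℝ} {a : ℝ}
    (hX : ∀ i, Measurable (X i)) (hW : ∀ i, Measurable (W i))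
    (hX01 : ∀ i, ∀ᵐ ω ∂μ, X i ω = 0 ∨ X i ω = 1) (hXg : ∀ i, μ.real {ω | X i ω = 1} = g i)
    (hindep : iIndepFun (fun i ω ↦ (X i ω, W i ω)) μ) (hXW : ∀ i, IndepFun (X i) (W i) μ)
    (hWid : ∀ i, IdentDistrib (W i) (W 0) μ μ) (h0 : μ[W 0] = 0) (h1 : μ[W 0 ^ 2] = 1)
    (ha : a ∈ Set.Icc (0 : ℝ) 1)
    (hg : Tendsto (fun T : ℕ ↦ (1 / (T : ℝ)) * ∑ i ∈ Finset.range T, g i) atTop (𝓝 a)) :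
    TendstoInDistribution (fun (T : ℕ) ω ↦ (√T)⁻¹ * ∑ i ∈ Finset.range T, (X i ω - a) * W i ω)
      atTop (fun x : ℝ ↦ √(a * (1 - a)) * x) (fun _ ↦ μ) (gaussianReal 0 1) where
  forall_aemeasurable T := by fun_prop
  aemeasurable_limit := by fun_prop
  tendsto := by
    refine ProbabilityMeasure.tendsto_iff_tendsto_charFun.2 fun t ↦ ?_
    have hg01 i : 0 ≤ g i ∧ g i ≤ 1 := by
      rw [← hXg i]; exact ⟨measureReal_nonneg, measureReal_le_one⟩
    have hindep' : iIndepFun (fun i ω ↦ (X i ω - a) * W i ω) μ :=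
      hindep.comp (fun _ p ↦ (p.1 - a) * p.2) fun _ ↦ by fun_prop
    set φ := charFun (μ.map (W 0)) with hφ
    have hcf (T : ℕ) : charFun (μ.map fun ω ↦ (√T)⁻¹ * ∑ i ∈ Finset.range T, (X i ω - a) * W i ω) t
        = ∏ i ∈ Finset.range T, (g i * φ ((1 - a) * ((√T)⁻¹ * t)) +
          (1 - g i) * φ (-a * ((√T)⁻¹ * t))) := by
      rw [charFun_map_mul_comp (by fun_prop),
        (hindep'.restrict _).charFun_map_fun_finsetSum_eq_prod (fun _ _ ↦ by fun_prop),
        Finset.prod_apply]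
      refine Finset.prod_congr rfl fun i _ ↦ ?_
      rw [charFun_map_bernoulli_sub_mul (hX i) (hW i) (hX01 i) (hXg i) (hXW i),
        (hWid i).map_eq]
    have hlim : charFun ((gaussianReal 0 1).map fun x : ℝ ↦ √(a * (1 - a)) * x) t =
        Complex.exp (-(t ^ 2 / 2 * (a * (1 - a)) : ℝ)) := by
      rw [charFun_map_mul_comp (by fun_prop), show (fun x : ℝ ↦ x) = id from rfl, Measure.map_id,
        charFun_gaussianReal]
      congr 1
      have := Real.sq_sqrt (mul_nonneg ha.1 (sub_nonneg.2 ha.2))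
      simp only [NNReal.coe_one]
      rw [← Complex.ofReal_pow, mul_pow, this]
      push_cast; ring
    simp only [ProbabilityMeasure.coe_mk, hcf, hlim]
    have : IsProbabilityMeasure (μ.map (W 0)) := Measure.isProbabilityMeasure_map (by fun_prop)
    have hφ1 u : ‖φ u‖ ≤ 1 := norm_charFun_le_one u
    set ρ : ℝ → ℝ := fun u ↦ ‖φ u - (1 - u ^ 2 / 2)‖ with hρ
    -- The remainder is `o(u ^ 2)` and `u ^ 2 = O(1 / T)`.
    have hρ0 (c : ℝ) : Tendsto (fun T : ℕ ↦ T * ρ (c * ((√T)⁻¹ * t))) atTop (𝓝 0) := by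
      have hu : Tendsto (fun T : ℕ ↦ c * ((√(T : ℝ))⁻¹ * t)) atTop (𝓝 0) := by
        have := ((tendsto_inv_atTop_zero.comp <| Real.tendsto_sqrt_atTop.comp <|
          tendsto_natCast_atTop_atTop (R := ℝ)).mul_const t).const_mul c
        simpa using this
      have h := ((taylor_charFun_two (hW 0).aemeasurable h0 h1).comp_tendsto hu).norm_left
      have h2 : (fun T : ℕ ↦ (c * ((√(T : ℝ))⁻¹ * t)) ^ 2) =O[atTop] fun T : ℕ ↦ (T : ℝ)⁻¹ := by
        refine IsBigO.of_bound (|(c * t) ^ 2|) (.of_forall fun T ↦ ?_)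
        have : (c * ((√(T : ℝ))⁻¹ * t)) ^ 2 = (c * t) ^ 2 * (T : ℝ)⁻¹ := by
          rw [mul_pow, mul_pow, inv_pow, Real.sq_sqrt (Nat.cast_nonneg _)]; ring
        rw [this, norm_mul, Real.norm_eq_abs]
      have h3 := (h.trans_isBigO h2).tendsto_div_nhds_zero
      refine h3.congr fun T ↦ ?_
      simp only [Function.comp_apply, hρ, div_inv_eq_mul]
      push_cast
      ring
    -- `q i` is `t ^ 2 / 2` times the variance of `(X i - a) * W i`. Since `g i` and `1 - g i` are
    -- at most 1, adding both remainders gives an error free of `i`.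
    refine tendsto_prod_exp_neg_of_norm_sub_le (C := t ^ 2)
      (q := fun i ↦ t ^ 2 / 2 * (g i * (1 - a) ^ 2 + (1 - g i) * a ^ 2))
      (r := fun T ↦ ρ ((1 - a) * ((√T)⁻¹ * t)) + ρ (-a * ((√T)⁻¹ * t))) ?_ ?_ ?_ ?_ ?_ ?_
    · intro i
      obtain ⟨h0, h1⟩ := hg01 i
      have := sub_nonneg.2 h1
      positivity
    · intro i
      obtain ⟨h0, h1⟩ := hg01 i
      have : (1 - a) ^ 2 ≤ 1 := pow_le_one₀ (by linarith [ha.2]) (by linarith [ha.1])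
      have : a ^ 2 ≤ 1 := pow_le_one₀ ha.1 ha.2
      have : g i * (1 - a) ^ 2 + (1 - g i) * a ^ 2 ≤ 1 := by nlinarith
      nlinarith [sq_nonneg t]
    · intro T i
      obtain ⟨h0, h1⟩ := hg01 i
      refine (norm_add_le _ _).trans ?_
      rw [norm_mul, norm_mul, ← Complex.ofReal_one, ← Complex.ofReal_sub, Complex.norm_real,
        Complex.norm_real, Real.norm_of_nonneg h0, Real.norm_of_nonneg (sub_nonneg.2 h1)]
      nlinarith [hφ1 ((1 - a) * ((√T)⁻¹ * t)), hφ1 (-a * ((√T)⁻¹ * t))]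
    · intro T i
      obtain ⟨h0, h1⟩ := hg01 i
      have hT : (T : ℝ)⁻¹ = (√(T : ℝ))⁻¹ ^ 2 := by
        rw [inv_pow, Real.sq_sqrt (Nat.cast_nonneg _)]
      have e : (g i * φ ((1 - a) * ((√T)⁻¹ * t)) + (1 - g i) * φ (-a * ((√T)⁻¹ * t)) -
          (1 - ((t ^ 2 / 2 * (g i * (1 - a) ^ 2 + (1 - g i) * a ^ 2) / T : ℝ) : ℂ))) =
          (g i : ℂ) * (φ ((1 - a) * ((√T)⁻¹ * t)) - (1 - (((1 - a) * ((√T)⁻¹ * t) : ℝ) : ℂ) ^ 2 / 2))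
          + ((1 - g i : ℝ) : ℂ) *
            (φ (-a * ((√T)⁻¹ * t)) - (1 - ((-a * ((√T)⁻¹ * t) : ℝ) : ℂ) ^ 2 / 2)) := by
        rw [div_eq_mul_inv (t ^ 2 / 2 * _), hT]
        push_cast
        ring
      rw [e]
      refine (norm_add_le _ _).trans ?_
      rw [norm_mul, norm_mul, Complex.norm_real,
        Complex.norm_real, Real.norm_of_nonneg h0, Real.norm_of_nonneg (sub_nonneg.2 h1)]
      refine add_le_add ?_ ?_
      · exact mul_le_of_le_one_left (norm_nonneg _) h1
      · exact mul_le_of_le_one_left (norm_nonneg _) (by linarith)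
    · simpa [mul_add] using (hρ0 (1 - a)).add (hρ0 (-a))
    · have h := ((hg.mul_const ((1 - a) ^ 2 - a ^ 2)).add_const (a ^ 2)).const_mul (t ^ 2 / 2)
      have e : t ^ 2 / 2 * (a * ((1 - a) ^ 2 - a ^ 2) + a ^ 2) = t ^ 2 / 2 * (a * (1 - a)) := by
        ring
      rw [e] at h
      refine h.congr' ?_
      filter_upwards [eventually_gt_atTop 0] with T hT
      have hT' : (T : ℝ) ≠ 0 := by positivity
      have : ∑ i ∈ Finset.range T, t ^ 2 / 2 * (g i * (1 - a) ^ 2 + (1 - g i) * a ^ 2) =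
          t ^ 2 / 2 * ((∑ i ∈ Finset.range T, g i) * ((1 - a) ^ 2 - a ^ 2) + T * a ^ 2) := by
        rw [← Finset.mul_sum, Finset.sum_mul, show (T : ℝ) * a ^ 2 = ∑ i ∈ Finset.range T, a ^ 2 by
          simp, ← Finset.sum_add_distrib]
        congr 1
        exact Finset.sum_congr rfl fun i _ ↦ by ring
      rw [this]
      field_simp

/-! ### Second-moment bounds and convergence in probability -/

/-- The sum of `T` independent centered variables with second moments at most `1` has `L²` norm
at most `√T`. -/
lemma eLpNorm_sum_le_sqrt {Z : ℕ → Ω → ℝ} (hZ : ∀ i, MemLp (Z i) 2 μ) (h0 : ∀ i, μ[Z i] = 0)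
    (h1 : ∀ i, ∫ ω, Z i ω ^ 2 ∂μ ≤ 1) (hindep : iIndepFun Z μ) (T : ℕ) :
    eLpNorm (fun ω ↦ ∑ i ∈ Finset.range T, Z i ω) 2 μ ≤ ENNReal.ofReal √T := by
  have hmem : MemLp (fun ω ↦ ∑ i ∈ Finset.range T, Z i ω) 2 μ :=
    memLp_finsetSum _ fun i _ ↦ hZ i
  have hint : ∫ ω, ∑ i ∈ Finset.range T, Z i ω ∂μ = 0 := by
    rw [integral_finsetSum _ fun i _ ↦ (hZ i).integrable (by norm_num)]
    simp [h0]
  have hvar : ∫ ω, (∑ i ∈ Finset.range T, Z i ω) ^ 2 ∂μ ≤ T := by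
    rw [← variance_of_integral_eq_zero hmem.aemeasurable hint]
    have := IndepFun.variance_sum (s := Finset.range T) (fun i _ ↦ hZ i)
      fun i _ j _ hij ↦ hindep.indepFun hij
    rw [show (fun ω ↦ ∑ i ∈ Finset.range T, Z i ω) = ∑ i ∈ Finset.range T, Z i by
      ext; simp, this]
    calc _ ≤ ∑ i ∈ Finset.range T, (1 : ℝ) := Finset.sum_le_sum fun i _ ↦ by
          rw [variance_of_integral_eq_zero (hZ i).aemeasurable (h0 i)]; exact h1 i
      _ = T := by simp
  rw [hmem.eLpNorm_eq_integral_rpow_norm (by norm_num) (by norm_num)]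
  refine ENNReal.ofReal_le_ofReal ?_
  simp only [ENNReal.toReal_ofNat, Real.rpow_ofNat, Real.norm_eq_abs, sq_abs]
  rw [Real.sqrt_eq_rpow, one_div]
  exact Real.rpow_le_rpow (integral_nonneg fun _ ↦ sq_nonneg _) hvar (by norm_num)

/-- The `L²` weak law of large numbers for independent Bernoulli variables. -/
lemma tendsto_eLpNorm_sampleMean_sub {X : ℕ → Ω → ℝ} {g : ℕ → ℝ} {a : ℝ}
    (hX : ∀ i, Measurable (X i))
    (hX01 : ∀ i, ∀ᵐ ω ∂μ, X i ω = 0 ∨ X i ω = 1) (hXg : ∀ i, μ.real {ω | X i ω = 1} = g i)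
    (hindep : iIndepFun X μ)
    (hg : Tendsto (fun T : ℕ ↦ (1 / (T : ℝ)) * ∑ i ∈ Finset.range T, g i) atTop (𝓝 a)) :
    Tendsto (fun T : ℕ ↦ eLpNorm (fun ω ↦ sampleMean T (fun i ↦ X i ω) - a) 2 μ) atTop (𝓝 0) := by
  have hmem i : MemLp (fun ω ↦ X i ω - g i) 2 μ := by
    refine MemLp.sub (MemLp.of_bound (by fun_prop) 1 ?_) (memLp_const _)
    filter_upwards [hX01 i] with ω hω
    rcases hω with h | h <;> simp [h]
  have hEX i : ∫ ω, X i ω ∂μ = g i := integral_bernoulli (hX i) (hX01 i) (hXg i)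
  have hg01 i : 0 ≤ g i ∧ g i ≤ 1 := by
    rw [← hXg i]; exact ⟨measureReal_nonneg, measureReal_le_one⟩
  have hXint i : Integrable (X i) μ := by
    have := ((hmem i).integrable (by norm_num)).add (integrable_const (g i))
    refine this.congr (.of_forall fun ω ↦ ?_)
    simp
  have hb (T : ℕ) := eLpNorm_sum_le_sqrt hmem
    (fun i ↦ by rw [integral_sub (hXint i) (integrable_const _), hEX]; simp)
    (fun i ↦ by
      calc ∫ ω, (X i ω - g i) ^ 2 ∂μ ≤ ∫ ω, (1 : ℝ) ∂μ := by
            refine integral_mono_ae (hmem i).integrable_sq (integrable_const _) ?_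
            filter_upwards [hX01 i] with ω hω
            obtain ⟨h0, h1⟩ := hg01 i
            rcases hω with h | h <;> simp only [h] <;> nlinarith
        _ = 1 := by simp)
    (hindep.comp (fun i x ↦ x - g i) fun _ ↦ by fun_prop) T
  -- Random fluctuation around the mean of the `g i`, plus the deterministic bias of that mean.
  have hle : ∀ᶠ T : ℕ in atTop, eLpNorm (fun ω ↦ sampleMean T (fun i ↦ X i ω) - a) 2 μ ≤
      ENNReal.ofReal ((√T)⁻¹ + |(1 / (T : ℝ)) * ∑ i ∈ Finset.range T, g i - a|) := by
    filter_upwards [eventually_gt_atTop 0] with T hT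
    have hT' : (0 : ℝ) < T := by positivity
    have e : (fun ω ↦ sampleMean T (fun i ↦ X i ω) - a) =
        (T : ℝ)⁻¹ • (fun ω ↦ ∑ i ∈ Finset.range T, (X i ω - g i)) +
          fun _ ↦ (1 / (T : ℝ)) * ∑ i ∈ Finset.range T, g i - a := by
      ext ω
      simp only [sampleMean, Pi.add_apply, Pi.smul_apply, smul_eq_mul, Finset.sum_sub_distrib]
      ring
    rw [e, ENNReal.ofReal_add (by positivity) (abs_nonneg _)]
    refine (eLpNorm_add_le (by fun_prop) (by fun_prop) (by norm_num)).trans (add_le_add ?_ ?_)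
    · rw [eLpNorm_const_smul, Real.enorm_of_nonneg (by positivity)]
      refine (mul_le_mul_right (hb T) _).trans ?_
      rw [← ENNReal.ofReal_mul (by positivity)]
      refine ENNReal.ofReal_le_ofReal (le_of_eq ?_)
      have := Real.sqrt_pos.2 hT'
      field_simp
      exact Real.sq_sqrt hT'.le
    · rw [eLpNorm_const _ (by norm_num) (IsProbabilityMeasure.ne_zero μ)]
      simp [Real.enorm_eq_ofReal_abs]
  refine tendsto_of_tendsto_of_tendsto_of_le_of_le' tendsto_const_nhds ?_ (.of_forall fun _ ↦
    zero_le) hle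
  have h1 : Tendsto (fun T : ℕ ↦ (√(T : ℝ))⁻¹) atTop (𝓝 0) :=
    tendsto_inv_atTop_zero.comp <| Real.tendsto_sqrt_atTop.comp <| tendsto_natCast_atTop_atTop
  have h2 := (hg.sub_const a).abs
  simpa [Function.comp_def] using (ENNReal.continuous_ofReal.tendsto _).comp (h1.add h2)

/-- Convergence in probability to a constant of a function of a sequence that converges in
probability and one that converges almost surely. -/
lemma tendstoInMeasure_comp_of_continuousAt {E F : Type*} [TopologicalSpace F]
    [PseudoEMetricSpace E] {A : ℕ → Ω → E} {B : ℕ → Ω → F} {a : E} {b : F} {f : E × F → ℝ}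
    (hA : TendstoInMeasure μ A atTop fun _ ↦ a)
    (hB : ∀ᵐ ω ∂μ, Tendsto (fun n ↦ B n ω) atTop (𝓝 b))
    (hf : ContinuousAt f (a, b))
    (hm : ∀ n, AEStronglyMeasurable (fun ω ↦ f (A n ω, B n ω)) μ) :
    TendstoInMeasure μ (fun n ω ↦ f (A n ω, B n ω)) atTop fun _ ↦ f (a, b) := by
  -- Subsequence criterion: along a further subsequence both inputs converge almost surely.
  refine (exists_seq_tendstoInMeasure_atTop_iff hm).2 fun ns hns ↦ ?_
  obtain ⟨ms, hms, h⟩ := (hA.comp hns.tendsto_atTop).exists_seq_tendsto_ae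
  refine ⟨ms, hms, ?_⟩
  filter_upwards [h, hB] with ω h1 h2
  exact hf.tendsto.comp
    (h1.prodMk_nhds (h2.comp (hns.tendsto_atTop.comp hms.tendsto_atTop)))

end

/-! ### Algebra of the sample correlation -/

lemma sampleCorr_affine_right (T : ℕ) (x w : ℕ → ℝ) {c m : ℝ} (hc : 0 < c) :
    sampleCorr T x (fun t ↦ c * w t + m) = sampleCorr T x w := by
  rcases T.eq_zero_or_pos with rfl | hT
  · simp [sampleCorr]
  have hT' : (T : ℝ) ≠ 0 := by positivity
  have hm : sampleMean T (fun t ↦ c * w t + m) = c * sampleMean T w + m := by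
    simp only [sampleMean, Finset.sum_add_distrib, ← Finset.mul_sum, Finset.sum_const,
      Finset.card_range, nsmul_eq_mul]
    field_simp
  have e t : c * w t + m - (c * sampleMean T w + m) = c * (w t - sampleMean T w) := by ring
  simp only [sampleCorr, hm, e, mul_pow, mul_left_comm _ c, mul_left_comm _ (c ^ 2),
    ← Finset.mul_sum]
  rw [Real.sqrt_mul (sq_nonneg c), Real.sqrt_sq hc.le, mul_div_mul_left _ _ hc.ne']

/-- The free constant `a` replaces the random centering of `x` by a deterministic one, leaving
independent summands. -/
lemma sum_sub_sampleMean_mul (T : ℕ) (hT : 0 < T) (x w : ℕ → ℝ) (a : ℝ) :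
    ∑ t ∈ Finset.range T, (x t - sampleMean T x) * (w t - sampleMean T w) =
      ∑ t ∈ Finset.range T, (x t - a) * w t -
        (sampleMean T x - a) * ∑ t ∈ Finset.range T, w t := by
  have hT' : (T : ℝ) ≠ 0 := by positivity
  have hx : ∑ t ∈ Finset.range T, x t = T * sampleMean T x := by
    rw [sampleMean]; field_simp
  have hw : ∑ t ∈ Finset.range T, w t = T * sampleMean T w := by
    rw [sampleMean]; field_simp
  have e t : (x t - sampleMean T x) * (w t - sampleMean T w) = (x t - a) * w t
      - (sampleMean T x - a) * w t - sampleMean T w * x t + sampleMean T x * sampleMean T w := by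
    ring
  simp only [e, Finset.sum_add_distrib, Finset.sum_sub_distrib, ← Finset.mul_sum, hx, hw,
    Finset.sum_const, Finset.card_range, nsmul_eq_mul]
  ring

lemma sum_sub_sampleMean_sq (T : ℕ) (hT : 0 < T) (w : ℕ → ℝ) :
    ∑ t ∈ Finset.range T, (w t - sampleMean T w) ^ 2 =
      T * (sampleMean T (fun t ↦ w t ^ 2) - sampleMean T w ^ 2) := by
  have hT' : (T : ℝ) ≠ 0 := by positivity
  have h := sum_sub_sampleMean_mul T hT w w 0
  simp only [sub_zero, ← pow_two] at h
  rw [h]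
  simp only [sampleMean]
  field_simp

/-- The normalized correlation coefficient with a `0`-`1` sequence in terms of normalized sums. -/
lemma sqrt_mul_sampleCorr (T : ℕ) (x w : ℕ → ℝ) (a : ℝ) (hx : ∀ t, x t = 0 ∨ x t = 1) :
    √T * sampleCorr T x w =
      ((√T)⁻¹ * ∑ t ∈ Finset.range T, (x t - a) * w t -
        (sampleMean T x - a) * ((√T)⁻¹ * ∑ t ∈ Finset.range T, w t)) *
      (√((sampleMean T x - sampleMean T x ^ 2) *
        (sampleMean T (fun t ↦ w t ^ 2) - sampleMean T w ^ 2)))⁻¹ := by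
  rcases T.eq_zero_or_pos with rfl | hT
  · simp
  have hT' : (0 : ℝ) < T := by positivity
  have hx2 : (fun t ↦ x t ^ 2) = x := by
    ext t; rcases hx t with h | h <;> simp [h]
  have hs := Real.sq_sqrt hT'.le
  have hs0 := Real.sqrt_pos.2 hT'
  rw [sampleCorr, sum_sub_sampleMean_mul T hT x w a, sum_sub_sampleMean_sq T hT,
    sum_sub_sampleMean_sq T hT, hx2]
  set D := (sampleMean T x - sampleMean T x ^ 2) *
    (sampleMean T (fun t ↦ w t ^ 2) - sampleMean T w ^ 2) with hD
  have e : T * (sampleMean T x - sampleMean T x ^ 2) *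
      (T * (sampleMean T (fun t ↦ w t ^ 2) - sampleMean T w ^ 2)) = (T : ℝ) ^ 2 * D := by
    rw [hD]; ring
  -- If `D = 0`, both sides vanish since `0⁻¹ = 0`.
  rw [e, Real.sqrt_mul (sq_nonneg _), Real.sqrt_sq hT'.le, div_eq_mul_inv, mul_inv,
    show (T : ℝ)⁻¹ = (√T)⁻¹ * (√T)⁻¹ by rw [← mul_inv, Real.mul_self_sqrt hT'.le]]
  field_simp

/-! ### Slutsky's theorem and the conclusion -/

/-- Asymptotic normality of the correlation coefficient of Bernoulli variables with standardized
i.i.d. variables. -/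
lemma tendstoInDistribution_sqrt_mul_sampleCorr {Ω : Type*} [MeasurableSpace Ω] {μ : Measure Ω}
    [IsProbabilityMeasure μ] {X W : ℕ → Ω → ℝ} {g : ℕ → ℝ} {a : ℝ}
    (hX : ∀ i, Measurable (X i)) (hW : ∀ i, Measurable (W i))
    (hX01 : ∀ i, ∀ᵐ ω ∂μ, X i ω = 0 ∨ X i ω = 1) (hXg : ∀ i, μ.real {ω | X i ω = 1} = g i)
    (hindep : iIndepFun (fun i ω ↦ (X i ω, W i ω)) μ) (hXW : ∀ i, IndepFun (X i) (W i) μ)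
    (hWid : ∀ i, IdentDistrib (W i) (W 0) μ μ) (hW2 : MemLp (W 0) 2 μ)
    (h0 : μ[W 0] = 0) (h1 : μ[W 0 ^ 2] = 1) (ha : a ∈ Set.Ioo (0 : ℝ) 1)
    (hg : Tendsto (fun T : ℕ ↦ (1 / (T : ℝ)) * ∑ i ∈ Finset.range T, g i) atTop (𝓝 a)) :
    TendstoInDistribution
      (fun (T : ℕ) (ω : Ω) ↦ √(T : ℝ) * sampleCorr T (fun i ↦ X i ω) (fun i ↦ W i ω))
      atTop (id : ℝ → ℝ) (fun _ ↦ μ) (gaussianReal 0 1) := by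
  have hXind : iIndepFun X μ := hindep.comp (fun _ p ↦ p.1) fun _ ↦ by fun_prop
  have hWind : iIndepFun W μ := hindep.comp (fun _ p ↦ p.2) fun _ ↦ by fun_prop
  have hmX (T : ℕ) : Measurable fun ω ↦ sampleMean T (fun i ↦ X i ω) := by
    unfold sampleMean; fun_prop
  have hmW (T : ℕ) : Measurable fun ω ↦ sampleMean T (fun i ↦ W i ω) := by
    unfold sampleMean; fun_prop
  have hmW2 (T : ℕ) : Measurable fun ω ↦ sampleMean T (fun i ↦ W i ω ^ 2) := by
    unfold sampleMean; fun_prop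
  have hclt := tendstoInDistribution_bernoulli_sub_mul hX hW hX01 hXg hindep hXW hWid h0 h1
    ⟨ha.1.le, ha.2.le⟩ hg
  have hXL2 := tendsto_eLpNorm_sampleMean_sub hX hX01 hXg hXind hg
  have hXbar : TendstoInMeasure μ (fun T ω ↦ sampleMean T (fun i ↦ X i ω)) atTop fun _ ↦ a :=
    tendstoInMeasure_of_tendsto_eLpNorm (p := 2) (by norm_num)
      (fun T ↦ (hmX T).aestronglyMeasurable) (by fun_prop) hXL2
  have hWsum (T : ℕ) : eLpNorm (fun ω ↦ (√(T : ℝ))⁻¹ * ∑ i ∈ Finset.range T, W i ω) 2 μ ≤ 1 := by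
    have hb := eLpNorm_sum_le_sqrt (fun i ↦ (hWid i).memLp_iff.2 hW2)
      (fun i ↦ (hWid i).integral_eq.trans h0)
      (fun i ↦ (((hWid i).sq).integral_eq.trans h1).le) hWind T
    have e : (fun ω ↦ (√(T : ℝ))⁻¹ * ∑ i ∈ Finset.range T, W i ω) =
      (√(T : ℝ))⁻¹ • fun ω ↦ ∑ i ∈ Finset.range T, W i ω := by ext; simp
    rw [e, eLpNorm_const_smul, Real.enorm_of_nonneg (by positivity)]
    refine (mul_le_mul_right hb _).trans ?_
    rw [← ENNReal.ofReal_mul (by positivity), ← ENNReal.ofReal_one]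
    exact ENNReal.ofReal_le_ofReal (inv_mul_le_one)
  -- By Cauchy–Schwarz the `L¹` norm is at most the `L²` norm of `X̄ - a`, which tends to 0, times a
  -- factor at most 1.
  have hrem : TendstoInMeasure μ (fun T ω ↦ (sampleMean T (fun i ↦ X i ω) - a) *
      ((√(T : ℝ))⁻¹ * ∑ i ∈ Finset.range T, W i ω)) atTop fun _ ↦ 0 := by
    refine tendstoInMeasure_of_tendsto_eLpNorm (p := 1) (by norm_num) (fun T ↦ ?_) (by fun_prop) ?_
    · exact (((hmX T).sub_const a).mul (by fun_prop)).aestronglyMeasurable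
    refine tendsto_of_tendsto_of_tendsto_of_le_of_le tendsto_const_nhds hXL2 (fun _ ↦ zero_le)
      fun T ↦ ?_
    have h := eLpNorm_smul_le_mul_eLpNorm (p := 2) (q := 2) (r := 1) (μ := μ)
      (φ := fun ω ↦ sampleMean T (fun i ↦ X i ω) - a)
      (f := fun ω ↦ (√(T : ℝ))⁻¹ * ∑ i ∈ Finset.range T, W i ω) (by fun_prop)
      ((hmX T).sub_const a).aestronglyMeasurable
    refine le_trans (le_of_eq ?_) (h.trans (mul_le_of_le_one_right zero_le (hWsum T)))
    congr 1
    ext ω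
    simp
  have hlln : ∀ᵐ ω ∂μ, Tendsto (fun T : ℕ ↦ (sampleMean T (fun i ↦ W i ω),
      sampleMean T (fun i ↦ W i ω ^ 2))) atTop (𝓝 ((0 : ℝ), (1 : ℝ))) := by
    have l1 := strong_law_ae_real W (hW2.integrable (by norm_num))
      (fun i j hij ↦ hWind.indepFun hij) hWid
    have l2 := strong_law_ae_real (fun i ω ↦ W i ω ^ 2) hW2.integrable_sq
      (fun i j hij ↦ (hWind.indepFun hij).comp (φ := fun x ↦ x ^ 2) (ψ := fun x ↦ x ^ 2)
        (by fun_prop) (by fun_prop)) (fun i ↦ (hWid i).sq)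
    filter_upwards [l1, l2] with ω h1' h2'
    rw [h0] at h1'
    have e : ∫ ω, W 0 ω ^ 2 ∂μ = 1 := h1
    rw [e] at h2'
    exact h1'.prodMk_nhds h2'
  have hvar : 0 < a * (1 - a) := mul_pos ha.1 (sub_pos.2 ha.2)
  have hden : TendstoInMeasure μ (fun T ω ↦ (√((sampleMean T (fun i ↦ X i ω) -
      sampleMean T (fun i ↦ X i ω) ^ 2) * (sampleMean T (fun i ↦ W i ω ^ 2) -
        sampleMean T (fun i ↦ W i ω) ^ 2)))⁻¹) atTop fun _ ↦ (√(a * (1 - a)))⁻¹ := by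
    have h := tendstoInMeasure_comp_of_continuousAt
      (f := fun p : ℝ × ℝ × ℝ ↦ (√((p.1 - p.1 ^ 2) * (p.2.2 - p.2.1 ^ 2)))⁻¹) hXbar hlln ?_ ?_
    · have e : (a - a ^ 2) * (1 - 0 ^ 2) = a * (1 - a) := by ring
      simp only [e] at h
      exact h
    · refine ContinuousAt.inv₀ (by fun_prop) ?_
      rw [show (a - a ^ 2) * (1 - 0 ^ 2) = a * (1 - a) by ring]
      exact (Real.sqrt_pos.2 hvar).ne'
    · intro T
      have := hmX T
      have := hmW T
      have := hmW2 T
      exact Measurable.aestronglyMeasurable (by fun_prop)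
  have hnum : TendstoInDistribution
      (fun (T : ℕ) ω ↦ (√(T : ℝ))⁻¹ * ∑ i ∈ Finset.range T, (X i ω - a) * W i ω -
        (sampleMean T (fun i ↦ X i ω) - a) * ((√(T : ℝ))⁻¹ * ∑ i ∈ Finset.range T, W i ω))
      atTop (fun x : ℝ ↦ √(a * (1 - a)) * x) (fun _ ↦ μ) (gaussianReal 0 1) := by
    have h := hclt.continuous_comp_prodMk_of_tendstoInMeasure_const
      (g := fun p : ℝ × ℝ ↦ p.1 - p.2) (by fun_prop) hrem
      (fun T ↦ (((hmX T).sub_const a).mul (by fun_prop)).aemeasurable)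
    simpa using h
  have hmain := hnum.continuous_comp_prodMk_of_tendstoInMeasure_const
    (g := fun p : ℝ × ℝ ↦ p.1 * p.2) (by fun_prop) hden (fun T ↦ by
      have := hmX T
      have := hmW T
      have := hmW2 T
      exact Measurable.aemeasurable (by fun_prop))
  refine hmain.congr (fun T ↦ ?_) (.of_forall fun x ↦ ?_)
  · filter_upwards [ae_all_iff.2 hX01] with ω hω
    exact (sqrt_mul_sampleCorr T _ _ a hω).symm
  · have := (Real.sqrt_pos.2 hvar).ne'
    simp only [id]
    field_simp

theorem lemma4p1 {Ω : Type*} [MeasurableSpace Ω] (μ : Measure Ω) [IsProbabilityMeasure μ]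
    (X Y : ℕ → Ω → ℝ) (g : ℕ → ℝ) (g₁ g₂ : ℝ)
    (hX : ∀ i, Measurable (X i)) (hY : ∀ i, Measurable (Y i))
    -- `X i` is Bernoulli with parameter `g i`
    (hX01 : ∀ i, ∀ᵐ ω ∂μ, X i ω = 0 ∨ X i ω = 1)
    (hXg : ∀ i, μ.real {ω | X i ω = 1} = g i)
    -- the pairs `(X i, Y i)` are mutually independent
    (hindep : iIndepFun (fun i ω ↦ (X i ω, Y i ω)) μ)
    -- cross-independence
    (hXY : ∀ i, IndepFun (X i) (Y i) μ)
    -- the `Y i` are identically distributed, not constant, with four finite moments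
    (hYid : ∀ i, IdentDistrib (Y i) (Y 0) μ μ)
    (hY4 : MemLp (Y 0) 4 μ)
    (hYvar : 0 < Var[Y 0; μ])
    (hg₁ : g₁ ∈ Set.Ioo (0 : ℝ) 1) (hg₂ : g₂ ∈ Set.Icc (0 : ℝ) 1)
    (hg_rate : (fun T : ℕ ↦ (1 / (T : ℝ)) * ∑ i ∈ Finset.range T, (g i - g₁))
      =O[atTop] fun T : ℕ ↦ 1 / (T : ℝ))
    (hg_sq : Tendsto (fun T : ℕ ↦ (1 / (T : ℝ)) * ∑ i ∈ Finset.range T, g i ^ 2)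
      atTop (𝓝 g₂)) :
    TendstoInDistribution
      (fun (T : ℕ) (ω : Ω) ↦ √(T : ℝ) * sampleCorr T (fun i ↦ X i ω) (fun i ↦ Y i ω))
      atTop (id : ℝ → ℝ) (fun _ ↦ μ) (gaussianReal 0 1) := by
  set m := μ[Y 0] with hm
  set v := Var[Y 0; μ]
  have hsv : 0 < √v := Real.sqrt_pos.2 hYvar
  have hY2 : MemLp (Y 0) 2 μ := hY4.mono_exponent (by norm_num)
  have hYint : Integrable (Y 0) μ := hY2.integrable (by norm_num)
  -- The `O(1 / T)` rate enters only through this Cesàro limit.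
  have hg : Tendsto (fun T : ℕ ↦ (1 / (T : ℝ)) * ∑ i ∈ Finset.range T, g i) atTop (𝓝 g₁) := by
    have h := (hg_rate.trans_tendsto tendsto_one_div_atTop_nhds_zero_nat).add_const g₁
    rw [zero_add] at h
    refine h.congr' ?_
    filter_upwards [eventually_gt_atTop 0] with T hT
    have hT' : (T : ℝ) ≠ 0 := by positivity
    rw [Finset.sum_sub_distrib, Finset.sum_const, Finset.card_range, nsmul_eq_mul]
    field_simp
    ring
  have h := tendstoInDistribution_sqrt_mul_sampleCorr (W := fun i ω ↦ (Y i ω - m) / √v) hX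
    (fun i ↦ by fun_prop) hX01 hXg
    (hindep.comp (fun _ p ↦ (p.1, (p.2 - m) / √v)) fun _ ↦ by fun_prop)
    (fun i ↦ (hXY i).comp (φ := id) (ψ := fun y ↦ (y - m) / √v) (by fun_prop) (by fun_prop))
    (fun i ↦ (hYid i).comp (u := fun y ↦ (y - m) / √v) (by fun_prop))
    (by simpa only [div_eq_mul_inv, Pi.sub_apply] using (hY2.sub (memLp_const m)).mul_const (√v)⁻¹)
    (by
      rw [integral_div, integral_sub hYint (integrable_const _)]
      simp [hm])
    (by
      simp only [Pi.pow_apply, div_pow]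
      rw [integral_div, ← variance_eq_integral (hY 0).aemeasurable,
        Real.sq_sqrt (variance_nonneg _ _), div_self hYvar.ne'])
    hg₁ hg
  refine h.congr (fun T ↦ .of_forall fun ω ↦ ?_) .rfl
  have e : (fun i ↦ Y i ω) = fun i ↦ √v * ((Y i ω - m) / √v) + m := by
    ext i
    field_simp
    ring
  simp only
  rw [e, sampleCorr_affine_right T _ _ hsv]
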